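/- Let $n\ge 0$, $[m]=\{1,\dots,m\}$, and order the symmetric group $S_n$ by strong Bruhat order $\le$. For $w\in S_n$ let $M_w$ be the $n\times 2n$ matrix whose entries in row $i$ and columns $w(i),w(i)+1,\dots,n+i$ are independent indeterminates and whose other entries are $0$; let $\mathcal P_w$ be the set of $n$-subsets $I\subseteq[2n]$ such that the $n\times n$ minor of $M_w$ in columns $I$ is nonzero (the bases of the matroid of $M_w$), and let $\mathbb Q_w=\mathcal P_w\setminus\bigcup_{v>w}\mathcal P_v$. An anti-fixed point of $w$ is an $i\in[n]$ with $w(i)=n-i+1$; a run of anti-fixed points is an inclusion-maximal nonempty interval of anti-fixed points. For a nonempty interval $K\subseteq[n]$ put $Z(K)=\{n-x+1:x\in K\}\cup\{n+x:x\in K\}$, and let the shifted Catalan matroid $\mathcal P_{K,n}$ be the image of $\mathcal P_{w_0}$, $w_0$ the reverse permutation in $S_{\#K}$, under the increasing bijection $[2\#K]\to Z(K)$. Let $L(w)$ be the set of left-to-right minima of $w$ (positions $i$ with $w(i)<w(j)$ for all $j<i$) that are not right-to-left maxima (positions $i$ with $w(i)>w(j)$ for all $j>i$), and $R(w)$ the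 set of right-to-left maxima that are not left-to-right minima. For families of sets, $\mathcal F\oplus\mathcal G=\{I\sqcup J: I\in\mathcal F,\ J\in\mathcal G\}$, where $\sqcup$ denotes disjoint union. Then: (a) If $v\le w$, then $\mathcal P_w\subseteq\mathcal P_v$. (b) The sets $\mathbb Q_w$, $w\in S_n$, are pairwise disjoint. (c) If $w$ contains the pattern $123$, then $\mathbb Q_w=\emptyset$. (d) If $w$ avoids $123$ and $A_1,\dots,A_k$ are its runs of anti-fixed points, then the sets $Z(A_1),\dots,Z(A_k)$, $w(L(w))$, $n+R(w)$ are pairwise disjoint, and $$\mathbb Q_w=\bigoplus_{i=1}^k\mathcal P_{A_i,n}\ \oplus\ \{w(L(w))\}\ \oplus\ \{n+R(w)\}.$$ Consequently the nonempty sets $\mathbb Q_v$, $v$ ranging over the $123$-avoiding permutations in $S_n$, partition the set $\binom{[2n]}{n}$ of $n$-subsets of $[2n]$; and for every $w\in S_n$, $\mathcal P_w$ is the (disjoint) union of the $\mathbb Q_v$ over all $123$-avoiding $v\ge w$. -/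

import Mathlib

/-!
Conventions: `Fin n` plays the role of `[n] = {1, …, n}` and `Fin (n + n)` that of
`[2n] = {1, …, 2n}`, with all labels lowered by one. Under this relabelling an element `x` of `[n]`,
regarded as an element of `[2n]`, is `Fin.castAdd n x`; the element `n + x` of `[2n]` is
`Fin.natAdd n x`; and `n - x + 1` is `Fin.rev x`.
-/

namespace PermPositroid

open Equiv

/-- One step up in (strong) Bruhat order: `u` is obtained from `v` by exchanging the values in
positions `i < j`, where `v i < v j`; that is, `u = v * t` for a transposition `t`, and `u` has more
inversions than `v`. -/
def BruhatStep {n : ℕ} (v u : Perm (Fin n)) : Prop :=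
  ∃ i j : Fin n, i < j ∧ v i < v j ∧ u = v * swap i j

/-- (Strong) Bruhat order `v ≤ w` on the symmetric group. -/
def BruhatLE {n : ℕ} (v w : Perm (Fin n)) : Prop :=
  Relation.ReflTransGen BruhatStep v w

/-- Strict Bruhat order `v < w`. -/
def BruhatLT {n : ℕ} (v w : Perm (Fin n)) : Prop :=
  BruhatLE v w ∧ v ≠ w

/-- `w` has no (not necessarily consecutive) increasing subsequence of length three. -/
def Avoids123 {n : ℕ} (w : Perm (Fin n)) : Prop :=
  ¬ ∃ i j k : Fin n, i < j ∧ j < k ∧ w i < w j ∧ w j < w k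

/-- The generic `n × 2n` matrix `M_w`: its nonzero entries are independent indeterminates, and
those of row `i` occupy the columns `w(i), …, n + i`. -/
noncomputable def genericMatrix {n : ℕ} (w : Perm (Fin n)) :
    Matrix (Fin n) (Fin (n + n)) (MvPolynomial (Fin n × Fin (n + n)) ℚ) :=
  fun i j =>
    if Fin.castAdd n (w i) ≤ j ∧ j ≤ Fin.natAdd n i then MvPolynomial.X (i, j) else 0

/-- `P_w`: the `n`-subsets `I` of `[2n]` such that the `n × n` minor of `M_w` in columns `I` is
nonzero. -/
def P {n : ℕ} (w : Perm (Fin n)) : Set (Finset (Fin (n + n))) :=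
  {I | ∃ h : I.card = n, ((genericMatrix w).submatrix id (I.orderEmbOfFin h)).det ≠ 0}

/-- `Q_w = P_w \ ⋃_{v > w} P_v`. -/
def Q {n : ℕ} (w : Perm (Fin n)) : Set (Finset (Fin (n + n))) :=
  P w \ ⋃ v ∈ {v : Perm (Fin n) | BruhatLT w v}, P v

/-- `i` is an anti-fixed point of `w`: in one-based labels, `w(i) = n - i + 1`. -/
def IsAntiFixed {n : ℕ} (w : Perm (Fin n)) (i : Fin n) : Prop :=
  w i = Fin.rev i

/-- `K` is a run of anti-fixed points of `w`: an inclusion-maximal one among the nonempty intervals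
of positions all of which are anti-fixed. -/
def IsRun {n : ℕ} (w : Perm (Fin n)) (K : Finset (Fin n)) : Prop :=
  Maximal (fun K' : Finset (Fin n) =>
    (∃ a b : Fin n, a ≤ b ∧ K' = Finset.Icc a b) ∧ ∀ i ∈ K', IsAntiFixed w i) K

/-- `Z_{#K} K = {n - x + 1 : x ∈ K} ∪ {n + x : x ∈ K}` (in one-based labels). -/
def Z {n : ℕ} (K : Finset (Fin n)) : Finset (Fin (n + n)) :=
  K.image (fun x => Fin.castAdd n (Fin.rev x)) ∪ K.image (fun x => Fin.natAdd n x)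

theorem card_Z {n : ℕ} (K : Finset (Fin n)) : (Z K).card = K.card + K.card := by
  unfold Z
  rw [Finset.card_union_of_disjoint, Finset.card_image_of_injective,
    Finset.card_image_of_injective]
  · exact Fin.natAdd_injective n n
  · exact (Fin.castAdd_injective n n).comp Fin.rev_injective
  · rw [Finset.disjoint_left]
    intro a ha hb
    simp only [Finset.mem_image] at ha hb
    obtain ⟨x, -, rfl⟩ := ha
    obtain ⟨y, -, hy⟩ := hb
    have h := congrArg Fin.val hy
    simp only [Fin.val_natAdd, Fin.val_castAdd] at h
    have := (Fin.rev x).isLt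
    omega

/-- The shifted Catalan matroid `P_{K,n}` (as its family of bases): the image of `P_{w₀}`, where
`w₀` is the reverse permutation in `S_{#K}`, under the increasing bijection
`[2 #K] → Z_{#K} K`. -/
def shiftedCatalan {n : ℕ} (K : Finset (Fin n)) : Set (Finset (Fin (n + n))) :=
  (fun J : Finset (Fin (K.card + K.card)) =>
    J.map ((Z K).orderEmbOfFin (card_Z K)).toEmbedding) '' P (Fin.revPerm : Perm (Fin K.card))

/-- `i` is a left-to-right minimum (position) of `w`. -/
def IsLRMin {n : ℕ} (w : Perm (Fin n)) (i : Fin n) : Prop :=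
  ∀ j : Fin n, j < i → w i < w j

/-- `i` is a right-to-left maximum (position) of `w`. -/
def IsRLMax {n : ℕ} (w : Perm (Fin n)) (i : Fin n) : Prop :=
  ∀ j : Fin n, i < j → w j < w i

open Classical in
/-- `L(w)`: the left-to-right minima which are not right-to-left maxima. -/
noncomputable def L {n : ℕ} (w : Perm (Fin n)) : Finset (Fin n) :=
  Finset.univ.filter fun i => IsLRMin w i ∧ ¬ IsRLMax w i

open Classical in
/-- `R(w)`: the right-to-left maxima which are not left-to-right minima. -/
noncomputable def R {n : ℕ} (w : Perm (Fin n)) : Finset (Fin n) :=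
  Finset.univ.filter fun i => IsRLMax w i ∧ ¬ IsLRMin w i

/-- The set `w(L(w))`, as a subset of `[2n]`. -/
noncomputable def wL {n : ℕ} (w : Perm (Fin n)) : Finset (Fin (n + n)) :=
  (L w).image fun i => Fin.castAdd n (w i)

/-- The set `n + R(w)`, as a subset of `[2n]`. -/
noncomputable def nR {n : ℕ} (w : Perm (Fin n)) : Finset (Fin (n + n)) :=
  (R w).image fun i => Fin.natAdd n i

/-- `F ⊕ G = {I ⊔ J : I ∈ F, J ∈ G}`, where `⊔` is disjoint union. -/
def directSum {α : Type*} (F G : Set (Finset α)) : Set (Finset α) :=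
  {S | ∃ I ∈ F, ∃ J ∈ G, Disjoint I J ∧ (S : Set α) = ↑I ∪ ↑J}

/-- The direct sum `⨁ᵢ Fᵢ` of an indexed collection of families of sets: all disjoint unions
`⨆ᵢ Iᵢ` with `Iᵢ ∈ Fᵢ`. -/
def iDirectSum {ι α : Type*} (F : ι → Set (Finset α)) : Set (Finset α) :=
  {S | ∃ I : ι → Finset α, (∀ i, I i ∈ F i) ∧ (∀ i j, i ≠ j → Disjoint (I i) (I j)) ∧
    (S : Set α) = ⋃ i, (I i : Set α)}

end PermPositroid

open PermPositroid

/-!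
By the Leibniz formula a minor of the generic matrix is nonzero exactly when its column set `I` is a
transversal of the intervals `[w(i), n + i]` (`mem_P_iff`), so everything is about matchings `σ` of
rows to columns. All the intervals contain the middle columns, whence one exchange shows that `P`
decreases along Bruhat order (`BruhatLE.P_subset`). Consequently `Q w` consists of the `I` for which
`w` is locally maximal: no single Bruhat step upwards keeps `I` in `P`
(`mem_Q_iff_isLocallyMaximal`). Climbing from any `w` with `I ∈ P w` reaches such a permutation, so
all the claims follow once it is known that `I` has only one locally maximal permutation, and what
it looks like.

Let `w` be locally maximal for `I`. For every matching `σ`, a pair `i < j` with `w i < w j` must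
satisfy `σ i < w j` and `n + i < σ j`, as otherwise the pair could be swapped. The middle term of a
123 pattern would then be matched both in the left and in the right half, so `w` avoids 123.
Induction on the position gives `σ i = w i` on `L w` and `σ i = n + i` on `R w`; since this holds for
*every* matching, exchanges show that an anti-fixed row is matched inside `Z K`, where `K` is its run
(`IsLocallyMaximal.isRigid`). Such rigid matchings are precisely the elements of the direct sum in
the theorem (`IsRigid.mem_runSum`, `exists_isRigid_of_mem_runSum`).

Conversely a 123-avoiding `w` can be read off from a set `I` with a rigid matching
(`IsRigid.unique`): counting `I` in symmetric windows around the middle detects the anti-fixed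
points, membership in `I` then gives `L w`, `R w` and their images, and `w` is decreasing on each of
the two. Hence having a rigid matching is equivalent to local maximality (`mem_Q_iff`), and the
locally maximal permutation of `I` is unique.
-/

namespace PermPositroid

open Equiv

variable {n : ℕ}

/-! ### Transversals -/

/-- `σ` exhibits `I` as a transversal of the column intervals `[w(i), n + i]`: it is a bijection
from the rows onto `I` with `σ i` in the support of row `i`. The bounds are stated in `ℕ`. -/
structure IsTransversal (w : Perm (Fin n)) (I : Finset (Fin (n + n)))
    (σ : Fin n → Fin (n + n)) : Prop where
  injective : Function.Injective σ
  image_eq : Finset.univ.image σ = I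
  le_apply : ∀ i, (w i : ℕ) ≤ σ i
  apply_le : ∀ i, (σ i : ℕ) ≤ n + i

theorem IsTransversal.mem {w : Perm (Fin n)} {I : Finset (Fin (n + n))}
    {σ : Fin n → Fin (n + n)} (h : IsTransversal w I σ) (i : Fin n) : σ i ∈ I := by
  rw [← h.image_eq]
  exact Finset.mem_image_of_mem _ (Finset.mem_univ _)

theorem IsTransversal.exists_eq {w : Perm (Fin n)} {I : Finset (Fin (n + n))}
    {σ : Fin n → Fin (n + n)} (h : IsTransversal w I σ) {x : Fin (n + n)} (hx : x ∈ I) :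
    ∃ i, σ i = x := by
  rw [← h.image_eq] at hx
  simpa using hx

theorem IsTransversal.card_eq {w : Perm (Fin n)} {I : Finset (Fin (n + n))}
    {σ : Fin n → Fin (n + n)} (h : IsTransversal w I σ) : I.card = n := by
  rw [← h.image_eq, Finset.card_image_of_injective _ h.injective, Finset.card_univ,
    Fintype.card_fin]

theorem IsTransversal.comp_perm {w u : Perm (Fin n)} {I : Finset (Fin (n + n))}
    {σ : Fin n → Fin (n + n)} (h : IsTransversal w I σ) (π : Perm (Fin n))
    (hl : ∀ i, (u i : ℕ) ≤ σ (π i)) (hu : ∀ i, (σ (π i) : ℕ) ≤ n + i) :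
    IsTransversal u I (σ ∘ π) where
  injective := h.injective.comp π.injective
  image_eq := by
    rw [← h.image_eq]
    ext x
    simp only [Finset.mem_image, Finset.mem_univ, true_and, Function.comp_apply]
    exact π.exists_congr_left.trans (by simp)
  le_apply := hl
  apply_le := hu

theorem IsTransversal.exchange {w : Perm (Fin n)} {I : Finset (Fin (n + n))}
    {σ : Fin n → Fin (n + n)} (h : IsTransversal w I σ) {i j : Fin n}
    (h1 : (w i : ℕ) ≤ σ j) (h2 : (σ j : ℕ) ≤ n + i)
    (h3 : (w j : ℕ) ≤ σ i) (h4 : (σ i : ℕ) ≤ n + j) :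
    IsTransversal w I (σ ∘ swap i j) := by
  refine h.comp_perm _ (fun k => ?_) (fun k => ?_)
  · rcases eq_or_ne k i with rfl | hi
    · simpa using h1
    rcases eq_or_ne k j with rfl | hj
    · simpa using h3
    rw [swap_apply_of_ne_of_ne hi hj]
    exact h.le_apply k
  · rcases eq_or_ne k i with rfl | hi
    · simpa using h2
    rcases eq_or_ne k j with rfl | hj
    · simpa using h4
    rw [swap_apply_of_ne_of_ne hi hj]
    exact h.apply_le k

/-- A minor of the generic matrix is nonzero exactly when its Leibniz expansion has a nonzero
term: distinct terms are distinct monomials, so nothing cancels. Specializing the indeterminates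
on one transversal to `1` and the others to `0` turns the minor into a permutation matrix. -/
theorem mem_P_iff {w : Perm (Fin n)} {I : Finset (Fin (n + n))} :
    I ∈ P w ↔ ∃ σ, IsTransversal w I σ := by
  constructor
  · rintro ⟨h, hdet⟩
    rw [Matrix.det_apply] at hdet
    obtain ⟨τ, -, hτ⟩ := Finset.exists_ne_zero_of_sum_ne_zero hdet
    have hτ' : ∀ i, genericMatrix w (τ i) (I.orderEmbOfFin h i) ≠ 0 := by
      intro i hi
      apply hτ
      rw [Finset.prod_eq_zero (Finset.mem_univ i) (by simpa using hi), smul_zero]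
    have key : ∀ i, Fin.castAdd n (w (τ i)) ≤ I.orderEmbOfFin h i ∧
        I.orderEmbOfFin h i ≤ Fin.natAdd n (τ i) := by
      intro i
      by_contra hc
      exact hτ' i (if_neg hc)
    refine ⟨fun i => I.orderEmbOfFin h (τ.symm i), ?_, ?_, fun i => ?_, fun i => ?_⟩
    · exact (I.orderEmbOfFin h).injective.comp τ.symm.injective
    · ext x
      simp only [Finset.mem_image, Finset.mem_univ, true_and]
      constructor
      · rintro ⟨i, rfl⟩
        exact I.orderEmbOfFin_mem h _
      · intro hx
        rw [← Finset.mem_coe, ← Finset.range_orderEmbOfFin I h] at hx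
        obtain ⟨j, rfl⟩ := hx
        exact ⟨τ j, by simp⟩
    · simpa using Fin.le_def.1 (key (τ.symm i)).1
    · have := Fin.le_def.1 (key (τ.symm i)).2
      rwa [apply_symm_apply] at this
  · rintro ⟨σ, hσ⟩
    have h := hσ.card_eq
    refine ⟨h, fun hdet => ?_⟩
    have hex : ∀ i, ∃ j, I.orderEmbOfFin h j = σ i := fun i => by
      have := hσ.mem i
      rw [← Finset.mem_coe, ← Finset.range_orderEmbOfFin I h] at this
      exact this
    choose τ hτ using hex
    have hτi : Function.Injective τ := fun i j hij =>
      hσ.injective (by rw [← hτ i, ← hτ j, hij])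
    let π : Perm (Fin n) := Equiv.ofBijective τ (Finite.injective_iff_bijective.1 hτi)
    let φ : MvPolynomial (Fin n × Fin (n + n)) ℚ →+* ℚ :=
      MvPolynomial.eval fun p => if p.2 = σ p.1 then 1 else 0
    have hmap : φ.mapMatrix ((genericMatrix w).submatrix id (I.orderEmbOfFin h)) =
        π.permMatrix ℚ := by
      ext i j
      simp only [RingHom.mapMatrix_apply, Matrix.map_apply, Matrix.submatrix_apply, id,
        Equiv.Perm.permMatrix, PEquiv.toMatrix_apply, Equiv.toPEquiv_apply, Option.mem_def,
        Option.some.injEq]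
      have hij : I.orderEmbOfFin h j = σ i ↔ π i = j := by
        rw [← hτ i, (I.orderEmbOfFin h).injective.eq_iff]
        exact eq_comm
      unfold genericMatrix
      by_cases hc : π i = j
      · have hb : Fin.castAdd n (w i) ≤ I.orderEmbOfFin h j ∧
            I.orderEmbOfFin h j ≤ Fin.natAdd n i := by
          rw [hij.2 hc]
          exact ⟨Fin.le_def.2 (hσ.le_apply i), Fin.le_def.2 (hσ.apply_le i)⟩
        rw [if_pos hb, if_pos hc]
        simp [φ, hij.2 hc]
      · rw [if_neg hc]
        split_ifs with hb
        · simp only [φ, MvPolynomial.eval_X]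
          exact if_neg fun hh => hc (hij.1 hh)
        · exact map_zero φ
    have h0 := congrArg φ hdet
    rw [RingHom.map_det, hmap, Matrix.det_permutation, map_zero] at h0
    rcases Int.units_eq_one_or (Perm.sign π) with h1 | h1 <;> simp [h1] at h0

theorem card_eq_of_mem_P {w : Perm (Fin n)} {I : Finset (Fin (n + n))} (h : I ∈ P w) :
    I.card = n := h.1

theorem mem_P_one {I : Finset (Fin (n + n))} (h : I.card = n) :
    I ∈ P (1 : Perm (Fin n)) := by
  have hlow : ∀ k (hk : k < n), k ≤ (I.orderEmbOfFin h ⟨k, hk⟩ : ℕ) := by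
    intro k
    induction k with
    | zero => intro _; exact Nat.zero_le _
    | succ k ih =>
      intro hk
      have h1 := ih (by omega)
      have h2 : I.orderEmbOfFin h ⟨k, by omega⟩ < I.orderEmbOfFin h ⟨k + 1, hk⟩ :=
        (I.orderEmbOfFin h).strictMono (Fin.mk_lt_mk.2 (Nat.lt_succ_self k))
      rw [Fin.lt_def] at h2
      omega
  have hup : ∀ d k (hk : k < n), k + d + 1 = n → (I.orderEmbOfFin h ⟨k, hk⟩ : ℕ) ≤ n + k := by
    intro d
    induction d with
    | zero => intro k hk hd; have := (I.orderEmbOfFin h ⟨k, hk⟩).isLt; omega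
    | succ d ih =>
      intro k hk hd
      have h1 := ih (k + 1) (by omega) (by omega)
      have h2 : I.orderEmbOfFin h ⟨k, hk⟩ < I.orderEmbOfFin h ⟨k + 1, by omega⟩ :=
        (I.orderEmbOfFin h).strictMono (Fin.mk_lt_mk.2 (Nat.lt_succ_self k))
      rw [Fin.lt_def] at h2
      omega
  refine mem_P_iff.2 ⟨I.orderEmbOfFin h, (I.orderEmbOfFin h).injective, ?_, ?_, ?_⟩
  · exact Finset.image_orderEmbOfFin_univ I h
  · exact fun i => hlow i i.isLt
  · exact fun i => hup (n - 1 - i) i i.isLt (by omega)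

/-! ### Bruhat order -/

/-- All the column intervals contain column `n - 1`, so a matching for the larger permutation can
be turned into one for the smaller by exchanging at most one pair. -/
theorem BruhatStep.P_subset {v u : Perm (Fin n)} (h : BruhatStep v u) : P u ⊆ P v := by
  obtain ⟨i, j, hij, hv, rfl⟩ := h
  intro I hI
  obtain ⟨σ, hσ⟩ := mem_P_iff.1 hI
  rw [Fin.lt_def] at hij hv
  have hli := hσ.le_apply i
  have hlj := hσ.le_apply j
  have hui := hσ.apply_le i
  have huj := hσ.apply_le j
  simp only [Perm.mul_apply, swap_apply_left, swap_apply_right] at hli hlj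
  have hl : ∀ k, k ≠ i → k ≠ j → (v k : ℕ) ≤ σ k := fun k h1 h2 => by
    have := hσ.le_apply k
    rwa [Perm.mul_apply, swap_apply_of_ne_of_ne h1 h2] at this
  rw [mem_P_iff]
  by_cases hc : (v j : ℕ) ≤ σ j
  · refine ⟨σ, hσ.injective, hσ.image_eq, fun k => ?_, hσ.apply_le⟩
    rcases eq_or_ne k i with rfl | h1
    · omega
    rcases eq_or_ne k j with rfl | h2
    · exact hc
    exact hl k h1 h2
  · refine ⟨σ ∘ swap i j, hσ.comp_perm _ (fun k => ?_) (fun k => ?_)⟩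
    · rcases eq_or_ne k i with rfl | h1
      · simpa using hlj
      rcases eq_or_ne k j with rfl | h2
      · simpa using hli
      rw [swap_apply_of_ne_of_ne h1 h2]
      exact hl k h1 h2
    · rcases eq_or_ne k i with rfl | h1
      · rw [swap_apply_left]; omega
      rcases eq_or_ne k j with rfl | h2
      · rw [swap_apply_right]; omega
      rw [swap_apply_of_ne_of_ne h1 h2]
      exact hσ.apply_le k

theorem BruhatLE.P_subset {v w : Perm (Fin n)} (h : BruhatLE v w) : P w ⊆ P v := by
  induction h with
  | refl => exact subset_rfl
  | tail _ hs ih => exact hs.P_subset.trans ih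

theorem BruhatStep.lex_lt {v u : Perm (Fin n)} (h : BruhatStep v u) :
    toLex (v : Fin n → Fin n) < toLex (u : Fin n → Fin n) := by
  obtain ⟨i, j, hij, hv, rfl⟩ := h
  refine ⟨i, fun k hk => ?_, ?_⟩
  · simp [swap_apply_of_ne_of_ne hk.ne (hk.trans hij).ne]
  · simpa using hv

theorem BruhatStep.ne {v u : Perm (Fin n)} (h : BruhatStep v u) : v ≠ u := by
  rintro rfl
  exact lt_irrefl _ h.lex_lt

/-- `w` is locally Bruhat-maximal among the permutations `u` with `I ∈ P u`. -/
def IsLocallyMaximal (w : Perm (Fin n)) (I : Finset (Fin (n + n))) : Prop :=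
  I ∈ P w ∧ ∀ u, BruhatStep w u → I ∉ P u

theorem mem_Q_iff_isLocallyMaximal {w : Perm (Fin n)} {I : Finset (Fin (n + n))} :
    I ∈ Q w ↔ IsLocallyMaximal w I := by
  simp only [Q, Set.mem_sdiff, Set.mem_iUnion, Set.mem_ofPred_eq, not_exists]
  refine and_congr_right fun _ => ⟨fun h u hu => ?_, fun h v hv hI => ?_⟩
  · exact h u ⟨Relation.ReflTransGen.single hu, hu.ne⟩
  · obtain ⟨hle, hne⟩ := hv
    rcases Relation.ReflTransGen.cases_head hle with h0 | ⟨u, hu, huv⟩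
    · exact hne h0
    · exact h u hu (BruhatLE.P_subset huv hI)

/-- Bruhat steps go up in the lexicographic order of one-line notations, so climbing terminates. -/
theorem exists_isLocallyMaximal (w : Perm (Fin n)) {I : Finset (Fin (n + n))} (h : I ∈ P w) :
    ∃ u, BruhatLE w u ∧ IsLocallyMaximal u I := by
  have wf : WellFounded fun a b : Perm (Fin n) =>
      toLex (b : Fin n → Fin n) < toLex (a : Fin n → Fin n) :=
    InvImage.wf (fun a : Perm (Fin n) => toLex (a : Fin n → Fin n))
      (wellFounded_gt (α := Lex (Fin n → Fin n)))
  induction w using wf.induction with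
  | _ w ih =>
    by_cases hc : ∃ u, BruhatStep w u ∧ I ∈ P u
    · obtain ⟨u, hu, hIu⟩ := hc
      obtain ⟨t, ht, hmax⟩ := ih u hu.lex_lt hIu
      exact ⟨t, Relation.ReflTransGen.head hu ht, hmax⟩
    · exact ⟨w, Relation.ReflTransGen.refl, h, fun u hu hI => hc ⟨u, hu, hI⟩⟩

/-! ### Positions of a permutation avoiding 123 -/

theorem isAntiFixed_iff {w : Perm (Fin n)} {k : Fin n} :
    IsAntiFixed w k ↔ (w k : ℕ) + k + 1 = n := by
  rw [IsAntiFixed, Fin.ext_iff, Fin.val_rev]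
  have := k.isLt
  omega

theorem card_Ioi_apply (w : Perm (Fin n)) (k : Fin n) :
    (Finset.univ.filter fun i => w k < w i).card = n - 1 - w k := by
  rw [← Fin.card_Ioi, ← Finset.card_image_of_injective _ w.injective]
  congr 1
  ext x
  simp only [Finset.mem_image, Finset.mem_filter, Finset.mem_univ, true_and, Finset.mem_Ioi]
  exact ⟨by rintro ⟨i, h, rfl⟩; exact h, fun h => ⟨w.symm x, by simpa using h, by simp⟩⟩

theorem card_Iio_apply (w : Perm (Fin n)) (k : Fin n) :
    (Finset.univ.filter fun i => w i < w k).card = w k := by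
  rw [← Fin.card_Iio (w k), ← Finset.card_image_of_injective _ w.injective]
  congr 1
  ext x
  simp only [Finset.mem_image, Finset.mem_filter, Finset.mem_univ, true_and, Finset.mem_Iio]
  exact ⟨by rintro ⟨i, h, rfl⟩; exact h, fun h => ⟨w.symm x, by simpa using h, by simp⟩⟩

theorem IsLRMin.add_lt {w : Perm (Fin n)} {k : Fin n} (h : IsLRMin w k) :
    (w k : ℕ) + k < n := by
  have hc : (Finset.Iio k).card ≤ (Finset.univ.filter fun i => w k < w i).card :=
    Finset.card_le_card fun i hi => by simpa using h i (Finset.mem_Iio.1 hi)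
  rw [card_Ioi_apply, Fin.card_Iio] at hc
  have := (w k).isLt
  omega

theorem IsRLMax.le_add {w : Perm (Fin n)} {k : Fin n} (h : IsRLMax w k) :
    n ≤ (w k : ℕ) + k + 1 := by
  have hc : (Finset.Ioi k).card ≤ (Finset.univ.filter fun i => w i < w k).card :=
    Finset.card_le_card fun i hi => by simpa using h i (Finset.mem_Ioi.1 hi)
  rw [card_Iio_apply, Fin.card_Ioi] at hc
  omega

theorem mem_L_iff {w : Perm (Fin n)} {i : Fin n} : i ∈ L w ↔ IsLRMin w i ∧ ¬ IsRLMax w i := by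
  simp [L]

theorem mem_R_iff {w : Perm (Fin n)} {i : Fin n} : i ∈ R w ↔ IsRLMax w i ∧ ¬ IsLRMin w i := by
  simp [R]

theorem exists_gt_of_mem_L {w : Perm (Fin n)} {i : Fin n} (h : i ∈ L w) :
    ∃ j, i < j ∧ w i < w j := by
  simp only [mem_L_iff, IsRLMax, not_forall] at h
  obtain ⟨-, j, hij, hj⟩ := h
  exact ⟨j, hij, lt_of_le_of_ne (not_lt.1 hj) fun e => hij.ne (w.injective e)⟩

theorem exists_lt_of_mem_R {w : Perm (Fin n)} {j : Fin n} (h : j ∈ R w) :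
    ∃ i, i < j ∧ w i < w j := by
  simp only [mem_R_iff, IsLRMin, not_forall] at h
  obtain ⟨-, i, hij, hj⟩ := h
  exact ⟨i, hij, lt_of_le_of_ne (not_lt.1 hj) fun e => hij.ne (w.injective e)⟩

namespace Avoids123

variable {w : Perm (Fin n)} (hw : Avoids123 w)
include hw

theorem mem_L {i j : Fin n} (hij : i < j) (h : w i < w j) : i ∈ L w := by
  rw [mem_L_iff]
  refine ⟨fun k hk => ?_, fun hR => (hR j hij).not_gt h⟩
  by_contra hc
  exact hw ⟨k, i, j, hk, hij,
    lt_of_le_of_ne (not_lt.1 hc) fun e => hk.ne (w.injective e), h⟩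

theorem mem_R {i j : Fin n} (hij : i < j) (h : w i < w j) : j ∈ R w := by
  rw [mem_R_iff]
  refine ⟨fun k hk => ?_, fun hL => (hL i hij).not_gt h⟩
  by_contra hc
  exact hw ⟨i, j, k, hij, hk, h,
    lt_of_le_of_ne (not_lt.1 hc) fun e => hk.ne (w.injective e)⟩

end Avoids123

theorem add_lt_of_mem_L {w : Perm (Fin n)} {i : Fin n} (h : i ∈ L w) :
    (w i : ℕ) + i + 1 < n := by
  obtain ⟨j, hij, hj⟩ := exists_gt_of_mem_L h
  have hmin : IsLRMin w i := (mem_L_iff.1 h).1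
  have hc : (insert j (Finset.Iio i)).card ≤ (Finset.univ.filter fun k => w i < w k).card :=
    Finset.card_le_card fun k hk => by
      rcases Finset.mem_insert.1 hk with rfl | hk
      · simpa using hj
      · simpa using hmin k (Finset.mem_Iio.1 hk)
  rw [Finset.card_insert_of_notMem (by simpa using hij.le), card_Ioi_apply, Fin.card_Iio] at hc
  omega

theorem lt_add_of_mem_R {w : Perm (Fin n)} {j : Fin n} (h : j ∈ R w) :
    n < (w j : ℕ) + j + 1 := by
  obtain ⟨i, hij, hi⟩ := exists_lt_of_mem_R h
  have hmax : IsRLMax w j := (mem_R_iff.1 h).1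
  have hc : (insert i (Finset.Ioi j)).card ≤ (Finset.univ.filter fun k => w k < w j).card :=
    Finset.card_le_card fun k hk => by
      rcases Finset.mem_insert.1 hk with rfl | hk
      · simpa using hi
      · simpa using hmax k (Finset.mem_Ioi.1 hk)
  rw [Finset.card_insert_of_notMem (by simpa using hij.le), card_Iio_apply, Fin.card_Ioi] at hc
  have := j.isLt
  omega

theorem IsAntiFixed.notMem_L {w : Perm (Fin n)} {k : Fin n} (h : IsAntiFixed w k) :
    k ∉ L w := fun hL => by
  have := add_lt_of_mem_L hL
  have := isAntiFixed_iff.1 h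
  omega

theorem IsAntiFixed.notMem_R {w : Perm (Fin n)} {k : Fin n} (h : IsAntiFixed w k) :
    k ∉ R w := fun hR => by
  have := lt_add_of_mem_R hR
  have := isAntiFixed_iff.1 h
  omega

theorem notMem_R_of_mem_L {w : Perm (Fin n)} {k : Fin n} (h : k ∈ L w) : k ∉ R w := fun hR => by
  have := add_lt_of_mem_L h
  have := lt_add_of_mem_R hR
  omega

namespace Avoids123

variable {w : Perm (Fin n)} (hw : Avoids123 w)
include hw

/-- In a permutation avoiding 123, the positions split into `L w`, `R w` and the anti-fixed
points. -/
theorem mem_L_or_mem_R_or_isAntiFixed (k : Fin n) : k ∈ L w ∨ k ∈ R w ∨ IsAntiFixed w k := by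
  by_cases hL : k ∈ L w
  · exact Or.inl hL
  by_cases hR : k ∈ R w
  · exact Or.inr (Or.inl hR)
  refine Or.inr (Or.inr ?_)
  have h1 : IsLRMin w k := fun j hj => by
    by_contra hc
    exact hR (hw.mem_R hj (lt_of_le_of_ne (not_lt.1 hc) fun e => hj.ne (w.injective e)))
  have h2 : IsRLMax w k := fun j hj => by
    by_contra hc
    exact hL (hw.mem_L hj (lt_of_le_of_ne (not_lt.1 hc) fun e => hj.ne (w.injective e)))
  rw [isAntiFixed_iff]
  have := h1.add_lt
  have := h2.le_add
  omega

theorem lt_of_lt_antiFixed {i k : Fin n} (hk : IsAntiFixed w k) (h : i < k) : w k < w i := by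
  by_contra hc
  exact hk.notMem_R (hw.mem_R h (lt_of_le_of_ne (not_lt.1 hc) fun e => h.ne (w.injective e)))

theorem lt_of_antiFixed_lt {j k : Fin n} (hk : IsAntiFixed w k) (h : k < j) : w j < w k := by
  by_contra hc
  exact hk.notMem_L (hw.mem_L h (lt_of_le_of_ne (not_lt.1 hc) fun e => h.ne (w.injective e)))

theorem strictAntiOn_L : StrictAntiOn w (L w) := fun i _ j hj hij => by
  by_contra hc
  exact notMem_R_of_mem_L hj
    (hw.mem_R hij (lt_of_le_of_ne (not_lt.1 hc) fun e => hij.ne (w.injective e)))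

theorem strictAntiOn_R : StrictAntiOn w (R w) := fun i hi j _ hij => by
  by_contra hc
  exact notMem_R_of_mem_L
    (hw.mem_L hij (lt_of_le_of_ne (not_lt.1 hc) fun e => hij.ne (w.injective e))) hi

end Avoids123

/-! ### Transversals of a locally maximal permutation -/

/-- A transversal that is rigid off the anti-fixed points: rows in `L w` take their leftmost
column, rows in `R w` their rightmost one, and an anti-fixed row `k` takes a column of the form
`n - k' - 1` or `n + k'` such that all positions from `k'` to `k` are anti-fixed; the last
condition says that the column lies in `Z K` for the run `K` of `k`. -/
structure IsRigid (w : Perm (Fin n)) (I : Finset (Fin (n + n)))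
    (σ : Fin n → Fin (n + n)) : Prop extends IsTransversal w I σ where
  apply_L : ∀ i ∈ L w, (σ i : ℕ) = w i
  apply_R : ∀ i ∈ R w, (σ i : ℕ) = n + i
  apply_antiFixed : ∀ k, IsAntiFixed w k → ∃ k' ≤ k,
    (∀ m, k' ≤ m → m ≤ k → IsAntiFixed w m) ∧ ((σ k : ℕ) + k' + 1 = n ∨ (σ k : ℕ) = n + k')

namespace IsLocallyMaximal

variable {w : Perm (Fin n)} {I : Finset (Fin (n + n))} {σ : Fin n → Fin (n + n)}
  (hI : IsLocallyMaximal w I)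
include hI

/-- If either inequality failed, the same matching or its exchange at `i, j` would serve
`w * swap i j`. -/
theorem lt_and_lt (hσ : IsTransversal w I σ) {i j : Fin n} (hij : i < j) (h : w i < w j) :
    (σ i : ℕ) < w j ∧ n + i < (σ j : ℕ) := by
  have hnot := hI.2 (w * swap i j) ⟨i, j, hij, h, rfl⟩
  rw [mem_P_iff, not_exists] at hnot
  rw [Fin.lt_def] at hij h
  have hwi := hσ.le_apply i
  have hwj := hσ.le_apply j
  have hui := hσ.apply_le i
  have huj := hσ.apply_le j
  constructor
  · by_contra hc
    refine hnot σ ⟨hσ.injective, hσ.image_eq, fun k => ?_, hσ.apply_le⟩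
    rw [Perm.mul_apply]
    rcases eq_or_ne k i with rfl | h1
    · rw [swap_apply_left]; omega
    rcases eq_or_ne k j with rfl | h2
    · rw [swap_apply_right]; omega
    rw [swap_apply_of_ne_of_ne h1 h2]
    exact hσ.le_apply k
  · by_contra hc
    refine hnot _ (hσ.comp_perm (swap i j) (fun k => ?_) (fun k => ?_))
    · rw [Perm.mul_apply]
      exact hσ.le_apply _
    · rcases eq_or_ne k i with rfl | h1
      · rw [swap_apply_left]; omega
      rcases eq_or_ne k j with rfl | h2
      · rw [swap_apply_right]; omega
      rw [swap_apply_of_ne_of_ne h1 h2]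
      exact hσ.apply_le k

theorem avoids123 : Avoids123 w := by
  rintro ⟨i, j, k, hij, hjk, h1, h2⟩
  obtain ⟨σ, hσ⟩ := mem_P_iff.1 hI.1
  have h3 := (hI.lt_and_lt hσ hij h1).2
  have h4 := (hI.lt_and_lt hσ hjk h2).1
  have := (w k).isLt
  omega

theorem apply_of_mem_L (hσ : IsTransversal w I σ) (i : Fin n) (hi : i ∈ L w) :
    (σ i : ℕ) = w i := by
  induction i using WellFoundedLT.induction with
  | _ i ih =>
    by_contra hne
    obtain ⟨j, hij, hwj⟩ := exists_gt_of_mem_L hi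
    have h1 := (hI.lt_and_lt hσ hij hwj).1
    have hle := hσ.le_apply i
    -- The column `σ i` is `w k` for some `k`; then `k < i` also lies in `L w`.
    obtain ⟨k, hk⟩ : ∃ k, (w k : ℕ) = σ i :=
      ⟨w.symm ⟨σ i, h1.trans (w j).isLt⟩, by rw [apply_symm_apply]⟩
    have hik : w i < w k := by rw [Fin.lt_def]; omega
    have hkj : w k < w j := by rw [Fin.lt_def]; omega
    rcases lt_trichotomy k i with h | rfl | h
    · have := ih k h (hI.avoids123.mem_L (h.trans hij) hkj)
      exact h.ne (hσ.injective (Fin.ext (by omega)))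
    · exact lt_irrefl _ hik
    · have := (hI.lt_and_lt hσ h hik).1
      omega

theorem apply_of_mem_R (hσ : IsTransversal w I σ) (j : Fin n) (hj : j ∈ R w) :
    (σ j : ℕ) = n + j := by
  induction j using WellFoundedLT.induction with
  | _ j ih =>
    by_contra hne
    obtain ⟨i, hij, hwi⟩ := exists_lt_of_mem_R hj
    have h1 := (hI.lt_and_lt hσ hij hwi).2
    have hle := hσ.apply_le j
    obtain ⟨k, hk⟩ : ∃ k : Fin n, n + (k : ℕ) = σ j :=
      ⟨⟨(σ j : ℕ) - n, by omega⟩, by simp only; omega⟩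
    have hkj : k < j := by rw [Fin.lt_def]; omega
    have hik : i < k := by rw [Fin.lt_def]; omega
    have hwk : w j < w k := by
      by_contra hc
      have := (hI.lt_and_lt hσ hkj
        (lt_of_le_of_ne (not_lt.1 hc) fun e => hkj.ne (w.injective e))).2
      omega
    have := ih k hkj (hI.avoids123.mem_R hik (hwi.trans hwk))
    exact hkj.ne (hσ.injective (Fin.ext (by omega)))

/-- The columns of anti-fixed rows cannot leave the run: otherwise an exchange with a row of `L w`
or `R w` would produce a transversal that is not rigid on that row. -/
theorem isRigid (hσ : IsTransversal w I σ) : IsRigid w I σ := by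
  have hw := hI.avoids123
  refine ⟨hσ, hI.apply_of_mem_L hσ, hI.apply_of_mem_R hσ, fun k hk => ?_⟩
  have hkw := isAntiFixed_iff.1 hk
  have hle := hσ.le_apply k
  have hup := hσ.apply_le k
  by_cases hlt : (σ k : ℕ) < n
  · have hno : ∀ m ∈ L w, m < k → ¬ (w m : ℕ) ≤ σ k := fun m hm hmk hc => by
      have hwm := hI.apply_of_mem_L hσ m hm
      have hkm := Fin.lt_def.1 (hw.lt_of_lt_antiFixed hk hmk)
      rw [Fin.lt_def] at hmk
      have h2 := hI.apply_of_mem_L (hσ.exchange (i := m) (j := k) hc (by omega) (by omega)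
        (by omega)) m hm
      rw [Function.comp_apply, swap_apply_left, ← hwm] at h2
      exact hmk.ne (congrArg Fin.val (hσ.injective (Fin.ext h2)).symm)
    obtain ⟨k', hk'⟩ : ∃ k', (w k' : ℕ) = σ k :=
      ⟨w.symm ⟨σ k, hlt⟩, by rw [apply_symm_apply]⟩
    have hk'k : k' ≤ k := by
      by_contra hc
      have := Fin.lt_def.1 (hw.lt_of_antiFixed_lt hk (not_le.1 hc))
      omega
    have hk'L : k' ∉ L w := fun h => by
      refine hno k' h (lt_of_le_of_ne hk'k ?_) hk'.le
      rintro rfl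
      exact hk.notMem_L h
    have hall : ∀ m, k' ≤ m → m ≤ k → IsAntiFixed w m := fun m h1 h2 => by
      rcases h2.eq_or_lt with rfl | h2
      · exact hk
      have hm : w m ≤ w k' := by
        rcases h1.eq_or_lt with rfl | h1
        · exact le_rfl
        exact not_lt.1 fun hc => hk'L (hw.mem_L h1 hc)
      rw [Fin.le_def] at hm
      rcases hw.mem_L_or_mem_R_or_isAntiFixed m with h | h | h
      · exact absurd (hm.trans hk'.le) (hno m h h2)
      · obtain ⟨i, him, hi⟩ := exists_lt_of_mem_R h
        have hi' := Fin.lt_def.1 hi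
        exact absurd (by omega) (hno i (hw.mem_L him hi) (him.trans h2))
      · exact h
    have := isAntiFixed_iff.1 (hall k' le_rfl hk'k)
    exact ⟨k', hk'k, hall, Or.inl (by omega)⟩
  · obtain ⟨k', hk'⟩ : ∃ k' : Fin n, n + (k' : ℕ) = σ k :=
      ⟨⟨(σ k : ℕ) - n, by have := (σ k).isLt; omega⟩, by simp only; omega⟩
    have hno : ∀ m ∈ R w, k' ≤ m → ¬ m < k := fun m hm hkm hmk => by
      have hwm := hI.apply_of_mem_R hσ m hm
      rw [Fin.le_def] at hkm
      rw [Fin.lt_def] at hmk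
      have h2 := hI.apply_of_mem_R (hσ.exchange (i := m) (j := k) (by omega) (by omega)
        (by omega) (by omega)) m hm
      rw [Function.comp_apply, swap_apply_left, ← hwm] at h2
      exact hmk.ne (congrArg Fin.val (hσ.injective (Fin.ext h2)).symm)
    refine ⟨k', by rw [Fin.le_def]; omega, fun m h1 h2 => ?_, Or.inr hk'.symm⟩
    rcases h2.eq_or_lt with rfl | h2
    · exact hk
    rcases hw.mem_L_or_mem_R_or_isAntiFixed m with h | h | h
    · obtain ⟨j, hmj, hj⟩ := exists_gt_of_mem_L h
      have hkm := hw.lt_of_lt_antiFixed hk h2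
      rcases lt_trichotomy j k with hjk | rfl | hjk
      · exact absurd hjk (hno j (hw.mem_R hmj hj) (h1.trans hmj.le))
      · exact absurd hj hkm.not_gt
      · exact absurd (hj.trans (hw.lt_of_antiFixed_lt hk hjk)) hkm.not_gt
    · exact absurd h2 (hno m h h1)
    · exact h

end IsLocallyMaximal

/-! ### Recovering the permutation from a rigid transversal -/

/-- The part of `I` in the symmetric window of `2t` columns around the middle; it consists of the
columns `n - x - 1` and `n + x` with `x < t`. -/
def window (I : Finset (Fin (n + n))) (t : ℕ) : Finset (Fin (n + n)) :=
  I.filter fun x => n ≤ (x : ℕ) + t ∧ (x : ℕ) < n + t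

namespace IsRigid

variable {w : Perm (Fin n)} {I : Finset (Fin (n + n))} {σ : Fin n → Fin (n + n)}

theorem le_card_window (h : IsRigid w I σ) (hw : Avoids123 w) {k : Fin n}
    (hk : IsAntiFixed w k) {t : ℕ} (h1 : (k : ℕ) ≤ t) (h2 : t ≤ k + 1) :
    t ≤ (window I t).card := by
  have hkw := isAntiFixed_iff.1 hk
  have hcard : (Finset.univ.filter fun i : Fin n => (i : ℕ) < t).card = t := by
    rw [Fin.card_filter_val_lt]
    have := k.isLt
    omega
  rw [← Finset.card_image_of_injective _ h.injective] at hcard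
  refine hcard.ge.trans (Finset.card_le_card fun x hx => ?_)
  obtain ⟨i, hi, rfl⟩ := Finset.mem_image.1 hx
  simp only [Finset.mem_filter, Finset.mem_univ, true_and] at hi
  refine Finset.mem_filter.2 ⟨h.mem i, ?_⟩
  have hle := h.le_apply i
  have hup := h.apply_le i
  rcases hw.mem_L_or_mem_R_or_isAntiFixed i with hi' | hi' | hi'
  · have hs := h.apply_L i hi'
    have hik : i < k := by
      refine lt_of_le_of_ne (by rw [Fin.le_def]; omega) ?_
      rintro rfl
      exact hk.notMem_L hi'
    have := Fin.lt_def.1 (hw.lt_of_lt_antiFixed hk hik)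
    omega
  · have := h.apply_R i hi'
    omega
  · have := isAntiFixed_iff.1 hi'
    omega

theorem lt_of_apply_mem_window (h : IsRigid w I σ) (hw : Avoids123 w) {k : Fin n}
    (hk : ¬ IsAntiFixed w k) {t : ℕ} (h1 : (k : ℕ) ≤ t) (h2 : t ≤ k + 1) {i : Fin n}
    (hi : σ i ∈ window I t) : (i : ℕ) < t := by
  obtain ⟨-, hi1, hi2⟩ := Finset.mem_filter.1 hi
  rcases hw.mem_L_or_mem_R_or_isAntiFixed i with hi' | hi' | hi'
  · have := h.apply_L i hi'
    have := add_lt_of_mem_L hi'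
    omega
  · have := h.apply_R i hi'
    omega
  · by_contra hc
    obtain ⟨k', -, hall, hor⟩ := h.apply_antiFixed i hi'
    exact hk (hall k (by rw [Fin.le_def]; omega) (by rw [Fin.le_def]; omega))

theorem card_window_lt_of_mem_L (h : IsRigid w I σ) (hw : Avoids123 w) {k : Fin n}
    (hk : k ∈ L w) : (window I (k + 1)).card < k + 1 := by
  have hsub : window I (k + 1) ⊆ (Finset.Iio k).image σ := fun x hx => by
    obtain ⟨i, rfl⟩ := h.exists_eq (Finset.mem_filter.1 hx).1
    have hi := h.lt_of_apply_mem_window hw (fun ha => ha.notMem_L hk) (Nat.le_succ _) le_rfl hx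
    refine Finset.mem_image_of_mem _ (Finset.mem_Iio.2 (lt_of_le_of_ne ?_ ?_))
    · rw [Fin.le_def]; omega
    · rintro rfl
      have := (Finset.mem_filter.1 hx).2
      have := h.apply_L i hk
      have := add_lt_of_mem_L hk
      omega
  have := (Finset.card_le_card hsub).trans Finset.card_image_le
  rw [Fin.card_Iio] at this
  omega

/-- If the window were full, the `k` rows before `k` would take the `k` largest values, so that
`w k` would lie on or below the antidiagonal, which is impossible for `k ∈ R w`. -/
theorem card_window_lt_of_mem_R (h : IsRigid w I σ) (hw : Avoids123 w) {k : Fin n}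
    (hk : k ∈ R w) : (window I k).card < k := by
  have hsub : window I k ⊆ (Finset.Iio k).image σ := fun x hx => by
    obtain ⟨i, rfl⟩ := h.exists_eq (Finset.mem_filter.1 hx).1
    have hi := h.lt_of_apply_mem_window hw (fun ha => ha.notMem_R hk) le_rfl (Nat.le_succ _) hx
    exact Finset.mem_image_of_mem _ (Finset.mem_Iio.2 (Fin.lt_def.2 hi))
  have hcard : ((Finset.Iio k).image σ).card = k := by
    rw [Finset.card_image_of_injective _ h.injective, Fin.card_Iio]
  have hle := Finset.card_le_card hsub
  rw [hcard] at hle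
  refine lt_of_le_of_ne hle fun heq => ?_
  have hwin := Finset.eq_of_subset_of_card_le hsub (by rw [hcard, heq])
  have hkR := lt_add_of_mem_R hk
  have hbig : ∀ i ∈ Finset.Iic k, n ≤ (w i : ℕ) + k := fun i hi => by
    rcases (Finset.mem_Iic.1 hi).eq_or_lt with rfl | hi
    · omega
    have hmem : σ i ∈ window I k := by
      rw [hwin]
      exact Finset.mem_image_of_mem _ (Finset.mem_Iio.2 hi)
    have hmem := (Finset.mem_filter.1 hmem).2
    rw [Fin.lt_def] at hi
    rcases hw.mem_L_or_mem_R_or_isAntiFixed i with hi' | hi' | hi'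
    · have := h.apply_L i hi'
      omega
    · have := lt_add_of_mem_R hi'
      omega
    · have := isAntiFixed_iff.1 hi'
      omega
  have hIci : (Finset.Iic k).image w ⊆ Finset.Ioi (Fin.rev k) := fun x hx => by
    obtain ⟨i, hi, rfl⟩ := Finset.mem_image.1 hx
    have := hbig i hi
    rw [Finset.mem_Ioi, Fin.lt_def, Fin.val_rev]
    have := k.isLt
    omega
  have := Finset.card_le_card hIci
  rw [Finset.card_image_of_injective _ w.injective, Fin.card_Iic, Fin.card_Ioi, Fin.val_rev] at this
  omega

/-- Anti-fixed points are visible from `I`: they are the `k` for which both windows, of radius `k`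
and `k + 1`, hold at least half of their columns. -/
theorem isAntiFixed_iff_card_window (h : IsRigid w I σ) (hw : Avoids123 w) (k : Fin n) :
    IsAntiFixed w k ↔ (k : ℕ) ≤ (window I k).card ∧ (k : ℕ) + 1 ≤ (window I (k + 1)).card := by
  constructor
  · exact fun hk => ⟨h.le_card_window hw hk le_rfl (Nat.le_succ _),
      h.le_card_window hw hk (Nat.le_succ _) le_rfl⟩
  · rintro ⟨h1, h2⟩
    rcases hw.mem_L_or_mem_R_or_isAntiFixed k with hk | hk | hk
    · exact absurd h2 (h.card_window_lt_of_mem_L hw hk).not_ge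
    · exact absurd h1 (h.card_window_lt_of_mem_R hw hk).not_ge
    · exact hk

theorem natAdd_mem_iff (h : IsRigid w I σ) (hw : Avoids123 w) {k : Fin n}
    (hk : ¬ IsAntiFixed w k) : Fin.natAdd n k ∈ I ↔ k ∈ R w := by
  constructor
  · intro hm
    obtain ⟨i, hi⟩ := h.exists_eq hm
    have hi := congrArg Fin.val hi
    rw [Fin.val_natAdd] at hi
    rcases hw.mem_L_or_mem_R_or_isAntiFixed i with hi' | hi' | hi'
    · have := h.apply_L i hi'
      have := (w i).isLt
      omega
    · have := h.apply_R i hi'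
      rwa [Fin.ext (a := k) (b := i) (by omega)]
    · obtain ⟨k', hk', hall, hor⟩ := h.apply_antiFixed i hi'
      have : k = k' := Fin.ext (by omega)
      exact absurd (hall k this.ge (this.trans_le hk')) hk
  · intro hk
    have : σ k = Fin.natAdd n k := Fin.ext (h.apply_R k hk)
    exact this ▸ h.mem k

theorem castAdd_mem_iff (h : IsRigid w I σ) (hw : Avoids123 w) {k : Fin n}
    (hk : ¬ IsAntiFixed w k) : Fin.castAdd n (w k) ∈ I ↔ k ∈ L w := by
  constructor
  · intro hm
    obtain ⟨i, hi⟩ := h.exists_eq hm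
    have hi := congrArg Fin.val hi
    rw [Fin.val_castAdd] at hi
    rcases hw.mem_L_or_mem_R_or_isAntiFixed i with hi' | hi' | hi'
    · have := h.apply_L i hi'
      rwa [w.injective (Fin.ext (a := w k) (b := w i) (by omega))]
    · have := h.apply_R i hi'
      have := (w k).isLt
      omega
    · obtain ⟨k', hk', hall, hor⟩ := h.apply_antiFixed i hi'
      have hk'a := hall k' le_rfl hk'
      have hk'w := isAntiFixed_iff.1 hk'a
      have hwk := (w k).isLt
      have : k = k' := w.injective (Fin.ext (by omega))
      exact absurd (this ▸ hk'a) hk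
  · intro hk
    have : σ k = Fin.castAdd n (w k) := Fin.ext (h.apply_L k hk)
    exact this ▸ h.mem k

end IsRigid

theorem eqOn_of_strictAntiOn_of_image_eq {α β : Type*} [LinearOrder α] [WellFoundedLT α]
    [LinearOrder β] {f g : α → β} {s : Set α} (hf : StrictAntiOn f s) (hg : StrictAntiOn g s)
    (h : f '' s = g '' s) : Set.EqOn f g s := by
  intro k
  induction k using WellFoundedLT.induction with
  | _ k ih =>
    intro hk
    rcases lt_trichotomy (f k) (g k) with hlt | heq | hlt
    · obtain ⟨i, hi, hik⟩ : g k ∈ f '' s := h ▸ Set.mem_image_of_mem g hk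
      have hlt' : i < k := (hf.lt_iff_gt hk hi).1 (hik ▸ hlt)
      exact absurd (hg.injOn hi hk ((ih i hlt' hi).symm.trans hik)) hlt'.ne
    · exact heq
    · obtain ⟨i, hi, hik⟩ : f k ∈ g '' s := h ▸ Set.mem_image_of_mem f hk
      have hlt' : i < k := (hg.lt_iff_gt hk hi).1 (hik ▸ hlt)
      exact absurd (hf.injOn hi hk ((ih i hlt' hi).trans hik)) hlt'.ne

/-- A 123-avoiding permutation is determined by any set with a rigid transversal: the windows give
the anti-fixed points, membership of the other `n + k` and `w k` gives `L w`, `R w` and their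
images, and `w` is decreasing on each of the two. -/
theorem IsRigid.unique {w w' : Perm (Fin n)} {I : Finset (Fin (n + n))}
    {σ σ' : Fin n → Fin (n + n)} (h : IsRigid w I σ) (h' : IsRigid w' I σ')
    (hw : Avoids123 w) (hw' : Avoids123 w') : w = w' := by
  have hA : ∀ k, IsAntiFixed w k ↔ IsAntiFixed w' k := fun k => by
    rw [h.isAntiFixed_iff_card_window hw, h'.isAntiFixed_iff_card_window hw']
  have hR : ∀ k, k ∈ R w ↔ k ∈ R w' := fun k => by
    by_cases hk : IsAntiFixed w k
    · exact iff_of_false hk.notMem_R ((hA k).1 hk).notMem_R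
    · rw [← h.natAdd_mem_iff hw hk, ← h'.natAdd_mem_iff hw' (mt (hA k).2 hk)]
  have hL : ∀ k, k ∈ L w ↔ k ∈ L w' := fun k => by
    have h1 := hw.mem_L_or_mem_R_or_isAntiFixed k
    have h2 := hw'.mem_L_or_mem_R_or_isAntiFixed k
    rw [← hR, ← hA] at h2
    constructor
    · exact fun hk => h2.resolve_right
        (not_or.2 ⟨notMem_R_of_mem_L hk, fun ha => ha.notMem_L hk⟩)
    · intro hk
      exact h1.resolve_right
        (not_or.2 ⟨fun hr => notMem_R_of_mem_L hk ((hR k).1 hr),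
          fun ha => ((hA k).1 ha).notMem_L hk⟩)
  -- The positions `k` and `k'` of one value are of the same kind, for `w` and `w'` respectively.
  have hpos : ∀ k k', w k = w' k' → (IsAntiFixed w k ↔ IsAntiFixed w' k') := fun k k' e => by
    constructor <;> intro ha
    · have hb := (hA k).1 ha
      have : k' = k := w'.injective (e.symm.trans (Eq.trans ha hb.symm))
      rwa [this]
    · have hb := (hA k').2 ha
      have : k = k' := w.injective (e.trans (Eq.trans ha hb.symm))
      rwa [this]
  have hLv : ∀ k k', w k = w' k' → (k ∈ L w ↔ k' ∈ L w') := fun k k' e => by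
    by_cases hk : IsAntiFixed w k
    · exact iff_of_false hk.notMem_L ((hpos k k' e).1 hk).notMem_L
    · rw [← h.castAdd_mem_iff hw hk, ← h'.castAdd_mem_iff hw' (mt (hpos k k' e).2 hk), e]
  have hRv : ∀ k k', w k = w' k' → (k ∈ R w ↔ k' ∈ R w') := fun k k' e => by
    have h1 := hw.mem_L_or_mem_R_or_isAntiFixed k
    have h2 := hw'.mem_L_or_mem_R_or_isAntiFixed k'
    rw [← hLv k k' e, ← hpos k k' e] at h2
    constructor
    · exact fun hk => (h2.resolve_left fun hl => notMem_R_of_mem_L hl hk).resolve_right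
        fun ha => ha.notMem_R hk
    · exact fun hk => (h1.resolve_left
        fun hl => notMem_R_of_mem_L ((hLv k k' e).1 hl) hk).resolve_right
        fun ha => ((hpos k k' e).1 ha).notMem_R hk
  have himL : w '' (L w : Set (Fin n)) = w' '' (L w : Set (Fin n)) := by
    ext v
    constructor
    · rintro ⟨k, hk, rfl⟩
      exact ⟨w'.symm (w k), (hL _).2 ((hLv k _ (by simp)).1 hk), by simp⟩
    · rintro ⟨k, hk, rfl⟩
      exact ⟨w.symm (w' k), (hLv _ k (by simp)).2 ((hL _).1 hk), by simp⟩
  have himR : w '' (R w : Set (Fin n)) = w' '' (R w : Set (Fin n)) := by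
    ext v
    constructor
    · rintro ⟨k, hk, rfl⟩
      exact ⟨w'.symm (w k), (hR _).2 ((hRv k _ (by simp)).1 hk), by simp⟩
    · rintro ⟨k, hk, rfl⟩
      exact ⟨w.symm (w' k), (hRv _ k (by simp)).2 ((hR _).1 hk), by simp⟩
  have hsL : StrictAntiOn w' (L w) := by
    rw [Finset.ext hL]
    exact hw'.strictAntiOn_L
  have hsR : StrictAntiOn w' (R w) := by
    rw [Finset.ext hR]
    exact hw'.strictAntiOn_R
  ext k : 1
  rcases hw.mem_L_or_mem_R_or_isAntiFixed k with hk | hk | hk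
  · exact eqOn_of_strictAntiOn_of_image_eq hw.strictAntiOn_L hsL himL hk
  · exact eqOn_of_strictAntiOn_of_image_eq hw.strictAntiOn_R hsR himR hk
  · exact Eq.trans hk ((hA k).1 hk).symm

/-- The locally maximal permutations of `I` are the 123-avoiding ones with a rigid transversal; in
particular, by `IsRigid.unique`, there is only one. -/
theorem mem_Q_iff {w : Perm (Fin n)} {I : Finset (Fin (n + n))} :
    I ∈ Q w ↔ Avoids123 w ∧ ∃ σ, IsRigid w I σ := by
  rw [mem_Q_iff_isLocallyMaximal]
  constructor
  · intro h
    obtain ⟨σ, hσ⟩ := mem_P_iff.1 h.1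
    exact ⟨h.avoids123, σ, h.isRigid hσ⟩
  · rintro ⟨hw, σ, hσ⟩
    obtain ⟨u, -, hu⟩ := exists_isLocallyMaximal w (mem_P_iff.2 ⟨σ, hσ.toIsTransversal⟩)
    obtain ⟨τ, hτ⟩ := mem_P_iff.1 hu.1
    rwa [hσ.unique (hu.isRigid hτ) hw hu.avoids123]

theorem disjoint_Q {v w : Perm (Fin n)} (h : v ≠ w) : Disjoint (Q v) (Q w) := by
  rw [Set.disjoint_left]
  intro I hv hw
  obtain ⟨hv, σ, hσ⟩ := mem_Q_iff.1 hv
  obtain ⟨hw, τ, hτ⟩ := mem_Q_iff.1 hw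
  exact h (hσ.unique hτ hv hw)

open Classical in
theorem Q_nonempty {w : Perm (Fin n)} (hw : Avoids123 w) : (Q w).Nonempty := by
  let σ : Fin n → Fin (n + n) := fun i => if i ∈ R w then Fin.natAdd n i else Fin.castAdd n (w i)
  have hR : ∀ i ∈ R w, (σ i : ℕ) = n + i := fun i hi => by simp only [σ, if_pos hi]; rfl
  have hnR : ∀ i ∉ R w, (σ i : ℕ) = w i := fun i hi => by simp only [σ, if_neg hi]; rfl
  refine ⟨Finset.univ.image σ, mem_Q_iff.2 ⟨hw, σ, ⟨fun i j hij => ?_, rfl, fun i => ?_,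
    fun i => ?_⟩, fun i hi => hnR i (notMem_R_of_mem_L hi), hR, fun k hk => ?_⟩⟩
  · have hij := congrArg Fin.val hij
    have hi' := (w i).isLt
    have hj' := (w j).isLt
    by_cases hi : i ∈ R w <;> by_cases hj : j ∈ R w
    · rw [hR i hi, hR j hj] at hij
      exact Fin.ext (by omega)
    · rw [hR i hi, hnR j hj] at hij
      omega
    · rw [hnR i hi, hR j hj] at hij
      omega
    · rw [hnR i hi, hnR j hj] at hij
      exact w.injective (Fin.ext hij)
  · have hi' := (w i).isLt
    by_cases hi : i ∈ R w
    · rw [hR i hi]; omega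
    · rw [hnR i hi]
  · have hi' := (w i).isLt
    by_cases hi : i ∈ R w
    · rw [hR i hi]
    · rw [hnR i hi]; omega
  · refine ⟨k, le_rfl, fun m h1 h2 => le_antisymm h1 h2 ▸ hk, Or.inl ?_⟩
    rw [hnR k hk.notMem_R]
    exact isAntiFixed_iff.1 hk

/-! ### Runs and shifted Catalan matroids -/

theorem mem_Z {K : Finset (Fin n)} {x : Fin (n + n)} :
    x ∈ Z K ↔ ∃ k ∈ K, (x : ℕ) + k + 1 = n ∨ (x : ℕ) = n + k := by
  simp only [Z, Finset.mem_union, Finset.mem_image, Fin.ext_iff, Fin.val_castAdd, Fin.val_natAdd,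
    Fin.val_rev]
  constructor
  · rintro (⟨k, hk, h⟩ | ⟨k, hk, h⟩)
    · exact ⟨k, hk, Or.inl (by have := k.isLt; omega)⟩
    · exact ⟨k, hk, Or.inr h.symm⟩
  · rintro ⟨k, hk, h | h⟩
    · exact Or.inl ⟨k, hk, by omega⟩
    · exact Or.inr ⟨k, hk, h.symm⟩

theorem disjoint_Z {K K' : Finset (Fin n)} (h : Disjoint K K') : Disjoint (Z K) (Z K') := by
  rw [Finset.disjoint_left] at h ⊢
  intro x hx hx'
  obtain ⟨k, hk, h1⟩ := mem_Z.1 hx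
  obtain ⟨k', hk', h2⟩ := mem_Z.1 hx'
  have : k = k' := Fin.ext (by omega)
  exact h hk (this ▸ hk')

/-- The increasing enumeration of `Z K` lists the reversed positions of `K`, then the shifted
ones. -/
theorem orderEmbOfFin_Z (K : Finset (Fin n)) (p : Fin K.card) :
    (Z K).orderEmbOfFin (card_Z K) (Fin.castAdd K.card (Fin.rev p)) =
        Fin.castAdd n (Fin.rev (K.orderEmbOfFin rfl p)) ∧
      (Z K).orderEmbOfFin (card_Z K) (Fin.natAdd K.card p) =
        Fin.natAdd n (K.orderEmbOfFin rfl p) := by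
  let f : Fin (K.card + K.card) → Fin (n + n) := Fin.addCases
    (fun q => Fin.castAdd n (Fin.rev (K.orderEmbOfFin rfl (Fin.rev q))))
    (fun q => Fin.natAdd n (K.orderEmbOfFin rfl q))
  have hl : ∀ q, f (Fin.castAdd _ q) = Fin.castAdd n (Fin.rev (K.orderEmbOfFin rfl (Fin.rev q))) :=
    fun q => Fin.addCases_left q
  have hr : ∀ q, f (Fin.natAdd _ q) = Fin.natAdd n (K.orderEmbOfFin rfl q) :=
    fun q => Fin.addCases_right q
  have hmem : ∀ x, f x ∈ Z K := fun x => by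
    refine Fin.addCases (fun q => ?_) (fun q => ?_) x
    · rw [hl]
      exact Finset.mem_union_left _ (Finset.mem_image_of_mem (fun x => Fin.castAdd n (Fin.rev x))
        (K.orderEmbOfFin_mem rfl _))
    · rw [hr]
      exact Finset.mem_union_right _ (Finset.mem_image_of_mem (fun x => Fin.natAdd n x)
        (K.orderEmbOfFin_mem rfl _))
  have hmono : StrictMono f := fun x y => by
    refine Fin.addCases (fun q => ?_) (fun q => ?_) x <;>
      refine Fin.addCases (fun r => ?_) (fun r => ?_) y <;> intro h <;> rw [Fin.lt_def] at h
    · rw [hl, hl]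
      have h : q < r := h
      exact Fin.rev_lt_rev.2 ((K.orderEmbOfFin rfl).strictMono (Fin.rev_lt_rev.2 h))
    · rw [hl, hr, Fin.lt_def, Fin.val_castAdd, Fin.val_natAdd]
      omega
    · rw [Fin.val_castAdd, Fin.val_natAdd] at h
      omega
    · rw [Fin.val_natAdd, Fin.val_natAdd] at h
      have h : q < r := Fin.lt_def.2 (by omega)
      rw [hr, hr, Fin.lt_def, Fin.val_natAdd, Fin.val_natAdd]
      have := Fin.lt_def.1 ((K.orderEmbOfFin rfl).strictMono h)
      omega
  rw [← Finset.orderEmbOfFin_unique (card_Z K) hmem hmono, hl, hr, Fin.rev_rev]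
  exact ⟨rfl, rfl⟩

theorem mem_shiftedCatalan_iff {K : Finset (Fin n)} {S : Finset (Fin (n + n))} :
    S ∈ shiftedCatalan K ↔ ∃ τ : Fin n → Fin (n + n), Set.InjOn τ K ∧ K.image τ = S ∧
      ∀ k ∈ K, τ k ∈ Z K ∧ n ≤ (τ k : ℕ) + k + 1 ∧ (τ k : ℕ) ≤ n + k := by
  set ι := (Z K).orderEmbOfFin (card_Z K) with hι
  set e := K.orderEmbOfFin rfl with he
  have hsurj : ∀ k ∈ K, ∃ p, e p = k := fun k hk => by
    rw [← Finset.mem_coe, ← Finset.range_orderEmbOfFin K rfl] at hk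
    exact hk
  have hbound : ∀ (p : Fin K.card) (x : Fin (K.card + K.card)),
      (((Fin.revPerm : Perm (Fin K.card)) p : ℕ) ≤ x ↔ n ≤ (ι x : ℕ) + e p + 1) ∧
      ((x : ℕ) ≤ K.card + p ↔ (ι x : ℕ) ≤ n + e p) := fun p x => by
    obtain ⟨h1, h2⟩ := orderEmbOfFin_Z K p
    have h3 := ι.le_iff_le (a := Fin.castAdd K.card (Fin.rev p)) (b := x)
    have h4 := ι.le_iff_le (a := x) (b := Fin.natAdd K.card p)
    rw [hι, h1, ← he, ← hι] at h3
    rw [hι, h2, ← he, ← hι] at h4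
    simp only [Fin.le_def, Fin.val_castAdd, Fin.val_natAdd, Fin.val_rev] at h3 h4
    rw [Fin.revPerm_apply, Fin.val_rev, ← h3, ← h4]
    have := (e p).isLt
    exact ⟨by omega, Iff.rfl⟩
  constructor
  · rintro ⟨J, hJ, rfl⟩
    obtain ⟨σ, hσ⟩ := mem_P_iff.1 hJ
    -- Off `K` the value of `τ` is irrelevant.
    have hex : ∀ k, ∃ y, ∀ p, e p = k → ι (σ p) = y := fun k => by
      by_cases hk : ∃ p, e p = k
      · obtain ⟨p, rfl⟩ := hk
        exact ⟨ι (σ p), fun q hq => by rw [e.injective hq]⟩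
      · exact ⟨Fin.castAdd n k, fun p hp => absurd ⟨p, hp⟩ hk⟩
    choose τ hτ using hex
    have hτe : ∀ p, τ (e p) = ι (σ p) := fun p => (hτ _ p rfl).symm
    refine ⟨τ, fun k hk k' hk' hkk => ?_, ?_, fun k hk => ?_⟩
    · obtain ⟨p, rfl⟩ := hsurj k hk
      obtain ⟨q, rfl⟩ := hsurj k' hk'
      rw [hτe, hτe] at hkk
      rw [hσ.injective (ι.injective hkk)]
    · rw [← hσ.image_eq]
      ext x
      simp only [Finset.mem_image, Finset.mem_map, Finset.mem_univ, true_and]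
      constructor
      · rintro ⟨k, hk, rfl⟩
        obtain ⟨p, rfl⟩ := hsurj k hk
        exact ⟨σ p, ⟨p, rfl⟩, (hτe p).symm⟩
      · rintro ⟨-, ⟨p, rfl⟩, rfl⟩
        exact ⟨e p, K.orderEmbOfFin_mem rfl p, hτe p⟩
    · obtain ⟨p, rfl⟩ := hsurj k hk
      rw [hτe]
      exact ⟨Finset.orderEmbOfFin_mem _ _ _, (hbound p _).1.1 (hσ.le_apply p),
        (hbound p _).2.1 (hσ.apply_le p)⟩
  · rintro ⟨τ, hinj, rfl, hτ⟩
    have hex : ∀ p, ∃ x, ι x = τ (e p) := fun p => by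
      have := (hτ (e p) (K.orderEmbOfFin_mem rfl p)).1
      rw [← Finset.mem_coe, ← Finset.range_orderEmbOfFin (Z K) (card_Z K)] at this
      exact this
    choose σ hσ using hex
    refine ⟨Finset.univ.image σ, mem_P_iff.2 ⟨σ, fun p q hpq => ?_, rfl, fun p => ?_, fun p => ?_⟩,
      ?_⟩
    · refine e.injective (hinj (K.orderEmbOfFin_mem rfl p) (K.orderEmbOfFin_mem rfl q) ?_)
      rw [← hσ, ← hσ, hpq]
    · rw [(hbound p _).1, hσ]
      exact (hτ (e p) (K.orderEmbOfFin_mem rfl p)).2.1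
    · rw [(hbound p _).2, hσ]
      exact (hτ (e p) (K.orderEmbOfFin_mem rfl p)).2.2
    · ext x
      simp only [Finset.mem_image, Finset.mem_map, Finset.mem_univ, true_and]
      constructor
      · rintro ⟨-, ⟨p, rfl⟩, rfl⟩
        exact ⟨e p, K.orderEmbOfFin_mem rfl p, (hσ p).symm⟩
      · rintro ⟨k, hk, rfl⟩
        obtain ⟨p, rfl⟩ := hsurj k hk
        exact ⟨σ p, ⟨p, rfl⟩, hσ p⟩

namespace IsRun

variable {w : Perm (Fin n)} {K K' : Finset (Fin n)}

theorem isAntiFixed (h : IsRun w K) {k : Fin n} (hk : k ∈ K) : IsAntiFixed w k :=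
  h.prop.2 k hk

theorem mem_of_between (h : IsRun w K) {a b m : Fin n} (ha : a ∈ K) (hb : b ∈ K) (h1 : a ≤ m)
    (h2 : m ≤ b) : m ∈ K := by
  obtain ⟨⟨c, d, -, rfl⟩, -⟩ := h.prop
  exact Finset.mem_Icc.2 ⟨(Finset.mem_Icc.1 ha).1.trans h1, h2.trans (Finset.mem_Icc.1 hb).2⟩

theorem Icc_subset (h : IsRun w K) {c d k : Fin n} (hk : k ∈ K) (hc : c ≤ k) (hd : k ≤ d)
    (hall : ∀ m, c ≤ m → m ≤ d → IsAntiFixed w m) : Finset.Icc c d ⊆ K := by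
  obtain ⟨⟨⟨a, b, hab, rfl⟩, hK⟩, hmax⟩ := h
  rw [Finset.mem_Icc] at hk
  have hsub : Finset.Icc (min a c) (max b d) ⊆ Finset.Icc a b := by
    refine hmax ⟨⟨_, _, ?_, rfl⟩, fun i hi => ?_⟩ ?_
    · exact (min_le_left _ _).trans (hab.trans (le_max_left _ _))
    · rw [Finset.mem_Icc, min_le_iff, le_max_iff] at hi
      by_cases hab : a ≤ i ∧ i ≤ b
      · exact hK i (Finset.mem_Icc.2 hab)
      · rcases le_total i k with hik | hik
        · refine hall i (hi.1.resolve_left fun hai => hab ⟨hai, hik.trans hk.2⟩) (hik.trans hd)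
        · refine hall i (hc.trans hik) (hi.2.resolve_left fun hbi => hab ⟨hk.1.trans hik, hbi⟩)
    · exact Finset.Icc_subset_Icc (min_le_left _ _) (le_max_left _ _)
  exact (Finset.Icc_subset_Icc (min_le_right _ _) (le_max_right _ _)).trans hsub

theorem subset_of_mem (h : IsRun w K) (h' : IsRun w K') {k : Fin n} (hk : k ∈ K) (hk' : k ∈ K') :
    K' ⊆ K := by
  obtain ⟨⟨c, d, -, rfl⟩, hall⟩ := h'.prop
  have hcd := Finset.mem_Icc.1 hk'
  exact h.Icc_subset hk hcd.1 hcd.2 fun m h1 h2 => hall m (Finset.mem_Icc.2 ⟨h1, h2⟩)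

theorem eq_of_mem (h : IsRun w K) (h' : IsRun w K') {k : Fin n} (hk : k ∈ K) (hk' : k ∈ K') :
    K = K' :=
  (h'.subset_of_mem h hk' hk).antisymm (h.subset_of_mem h' hk hk')

theorem disjoint (h : IsRun w K) (h' : IsRun w K') (hne : K ≠ K') : Disjoint K K' :=
  Finset.disjoint_left.2 fun _ hk hk' => hne (h.eq_of_mem h' hk hk')

end IsRun

theorem IsAntiFixed.exists_isRun {w : Perm (Fin n)} {k : Fin n} (h : IsAntiFixed w k) :
    ∃ K, IsRun w K ∧ k ∈ K := by
  obtain ⟨K, hK, hmax⟩ := Finite.exists_le_maximal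
    (p := fun K' : Finset (Fin n) =>
      (∃ a b : Fin n, a ≤ b ∧ K' = Finset.Icc a b) ∧ ∀ i ∈ K', IsAntiFixed w i) (a := {k})
    ⟨⟨k, k, le_rfl, by simp⟩, fun i hi => by rwa [Finset.mem_singleton.1 hi]⟩
  exact ⟨K, hmax, hK (Finset.mem_singleton_self k)⟩

theorem mem_wL {w : Perm (Fin n)} {x : Fin (n + n)} : x ∈ wL w ↔ ∃ i ∈ L w, (x : ℕ) = w i := by
  simp only [wL, Finset.mem_image, Fin.ext_iff, Fin.val_castAdd, eq_comm]

theorem mem_nR {w : Perm (Fin n)} {x : Fin (n + n)} : x ∈ nR w ↔ ∃ i ∈ R w, (x : ℕ) = n + i := by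
  simp only [nR, Finset.mem_image, Fin.ext_iff, Fin.val_natAdd, eq_comm]

theorem IsRun.disjoint_wL {w : Perm (Fin n)} {K : Finset (Fin n)} (h : IsRun w K) :
    Disjoint (Z K) (wL w) := by
  rw [Finset.disjoint_left]
  intro x hx hx'
  obtain ⟨k, hk, hxk⟩ := mem_Z.1 hx
  obtain ⟨i, hi, hxi⟩ := mem_wL.1 hx'
  have hka := isAntiFixed_iff.1 (h.isAntiFixed hk)
  have := (w i).isLt
  have : k = i := w.injective (Fin.ext (by omega))
  exact (h.isAntiFixed hk).notMem_L (this ▸ hi)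

theorem IsRun.disjoint_nR {w : Perm (Fin n)} {K : Finset (Fin n)} (h : IsRun w K) :
    Disjoint (Z K) (nR w) := by
  rw [Finset.disjoint_left]
  intro x hx hx'
  obtain ⟨k, hk, hxk⟩ := mem_Z.1 hx
  obtain ⟨i, hi, hxi⟩ := mem_nR.1 hx'
  have : k = i := Fin.ext (by omega)
  exact (h.isAntiFixed hk).notMem_R (this ▸ hi)

theorem disjoint_wL_nR (w : Perm (Fin n)) : Disjoint (wL w) (nR w) := by
  rw [Finset.disjoint_left]
  intro x hx hx'
  obtain ⟨i, hi, hxi⟩ := mem_wL.1 hx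
  obtain ⟨j, hj, hxj⟩ := mem_nR.1 hx'
  have := (w i).isLt
  omega

/-! ### The direct sum decomposition -/

/-- The sum of the shifted Catalan matroids of the runs of `w`, of `w(L(w))` and of `n + R(w)`. -/
def runSum (w : Perm (Fin n)) : Set (Finset (Fin (n + n))) :=
  directSum
    (directSum (iDirectSum fun K : {K : Finset (Fin n) // IsRun w K} => shiftedCatalan K.1) {wL w})
    {nR w}

open Classical in
theorem IsRigid.mem_runSum {w : Perm (Fin n)} (hw : Avoids123 w) {I : Finset (Fin (n + n))}
    {σ : Fin n → Fin (n + n)} (h : IsRigid w I σ) : I ∈ runSum w := by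
  have hZ : ∀ K, IsRun w K → ∀ k ∈ K, σ k ∈ Z K := fun K hK k hk => by
    obtain ⟨k', hk', hall, hor⟩ := h.apply_antiFixed k (hK.isAntiFixed hk)
    exact mem_Z.2 ⟨k', hK.Icc_subset hk hk' le_rfl hall
      (Finset.mem_Icc.2 ⟨le_rfl, hk'⟩), hor⟩
  have hsubZ : ∀ K, IsRun w K → K.image σ ⊆ Z K := fun K hK => by
    intro x hx
    obtain ⟨k, hk, rfl⟩ := Finset.mem_image.1 hx
    exact hZ K hK k hk
  let A : Finset (Fin (n + n)) := I.filter fun x => ∃ K, IsRun w K ∧ x ∈ K.image σ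
  have hA : ∀ x, x ∈ A ↔ ∃ K, IsRun w K ∧ x ∈ K.image σ := fun x => by
    refine ⟨fun hx => (Finset.mem_filter.1 hx).2, fun hx => Finset.mem_filter.2 ⟨?_, hx⟩⟩
    obtain ⟨K, -, hx⟩ := hx
    obtain ⟨k, -, rfl⟩ := Finset.mem_image.1 hx
    exact h.mem k
  have hAL : Disjoint A (wL w) := Finset.disjoint_left.2 fun x hx hx' => by
    obtain ⟨K, hK, hx⟩ := (hA x).1 hx
    exact Finset.disjoint_left.1 hK.disjoint_wL (hsubZ K hK hx) hx'
  have hAR : Disjoint A (nR w) := Finset.disjoint_left.2 fun x hx hx' => by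
    obtain ⟨K, hK, hx⟩ := (hA x).1 hx
    exact Finset.disjoint_left.1 hK.disjoint_nR (hsubZ K hK hx) hx'
  refine ⟨A ∪ wL w, ⟨A, ⟨fun K => K.1.image σ, fun K => ?_, fun K K' hne => ?_, ?_⟩, wL w, rfl,
    hAL, Finset.coe_union _ _⟩, nR w, rfl,
    Finset.disjoint_union_left.2 ⟨hAR, disjoint_wL_nR w⟩, ?_⟩
  · refine mem_shiftedCatalan_iff.2 ⟨σ, h.injective.injOn, rfl, fun k hk => ⟨hZ K.1 K.2 k hk, ?_,
      h.apply_le k⟩⟩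
    have := h.le_apply k
    have := isAntiFixed_iff.1 (K.2.isAntiFixed hk)
    omega
  · exact (disjoint_Z (K.2.disjoint K'.2 fun e => hne (Subtype.ext e))).mono
      (hsubZ K.1 K.2) (hsubZ K'.1 K'.2)
  · ext x
    simp only [Finset.mem_coe, Set.mem_iUnion, hA, Subtype.exists, exists_prop]
  · ext x
    simp only [Finset.mem_coe, Set.mem_union, Finset.mem_union]
    constructor
    · intro hx
      obtain ⟨i, rfl⟩ := h.exists_eq hx
      rcases hw.mem_L_or_mem_R_or_isAntiFixed i with hi | hi | hi
      · exact Or.inl (Or.inr (mem_wL.2 ⟨i, hi, h.apply_L i hi⟩))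
      · exact Or.inr (mem_nR.2 ⟨i, hi, h.apply_R i hi⟩)
      · obtain ⟨K, hK, hiK⟩ := hi.exists_isRun
        exact Or.inl (Or.inl ((hA _).2 ⟨K, hK, Finset.mem_image_of_mem _ hiK⟩))
    · rintro ((hx | hx) | hx)
      · exact (Finset.mem_filter.1 hx).1
      · obtain ⟨i, hi, hxi⟩ := mem_wL.1 hx
        rw [Fin.ext (hxi.trans (h.apply_L i hi).symm)]
        exact h.mem i
      · obtain ⟨i, hi, hxi⟩ := mem_nR.1 hx
        rw [Fin.ext (hxi.trans (h.apply_R i hi).symm)]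
        exact h.mem i

theorem exists_isRigid_of_mem_runSum {w : Perm (Fin n)} (hw : Avoids123 w)
    {I : Finset (Fin (n + n))} (h : I ∈ runSum w) : ∃ σ, IsRigid w I σ := by
  obtain ⟨A', ⟨A, ⟨S, hS, -, hAS⟩, _, rfl, -, hA'⟩, _, rfl, -, hI⟩ := h
  choose τ hinj himg hτ using fun K => mem_shiftedCatalan_iff.1 (hS K)
  have hex : ∀ k, ∃ x : Fin (n + n), (k ∈ L w → (x : ℕ) = w k) ∧ (k ∈ R w → (x : ℕ) = n + k) ∧
      ∀ K : {K : Finset (Fin n) // IsRun w K}, k ∈ K.1 → x = τ K k := fun k => by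
    rcases hw.mem_L_or_mem_R_or_isAntiFixed k with hk | hk | hk
    · exact ⟨Fin.castAdd n (w k), fun _ => rfl, fun h => absurd h (notMem_R_of_mem_L hk),
        fun K hK => absurd hk (K.2.isAntiFixed hK).notMem_L⟩
    · exact ⟨Fin.natAdd n k, fun h => absurd hk (notMem_R_of_mem_L h), fun _ => rfl,
        fun K hK => absurd hk (K.2.isAntiFixed hK).notMem_R⟩
    · obtain ⟨K, hK, hkK⟩ := hk.exists_isRun
      refine ⟨τ ⟨K, hK⟩ k, fun h => absurd h hk.notMem_L, fun h => absurd h hk.notMem_R,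
        fun K' hK' => ?_⟩
      rw [Subtype.ext (a1 := ⟨K, hK⟩) (a2 := K') (hK.eq_of_mem K'.2 hkK hK')]
  choose σ hσL hσR hσA using hex
  have hrun : ∀ k, IsAntiFixed w k → ∃ K : {K : Finset (Fin n) // IsRun w K}, k ∈ K.1 ∧
      σ k = τ K k ∧ σ k ∈ Z K.1 ∧ n ≤ (σ k : ℕ) + k + 1 ∧ (σ k : ℕ) ≤ n + k := fun k hk => by
    obtain ⟨K, hK, hkK⟩ := hk.exists_isRun
    have he := hσA k ⟨K, hK⟩ hkK
    refine ⟨⟨K, hK⟩, hkK, he, ?_⟩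
    rw [he]
    exact hτ ⟨K, hK⟩ k hkK
  have hmemL : ∀ i ∈ L w, σ i ∈ wL w := fun i hi => mem_wL.2 ⟨i, hi, hσL i hi⟩
  have hmemR : ∀ i ∈ R w, σ i ∈ nR w := fun i hi => mem_nR.2 ⟨i, hi, hσR i hi⟩
  refine ⟨σ, ⟨fun i j hij => ?_, ?_, fun i => ?_, fun i => ?_⟩, hσL, hσR, fun k hk => ?_⟩
  · rcases hw.mem_L_or_mem_R_or_isAntiFixed i with hi | hi | hi <;>
      rcases hw.mem_L_or_mem_R_or_isAntiFixed j with hj | hj | hj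
    · exact w.injective (Fin.ext (by rw [← hσL i hi, ← hσL j hj, hij]))
    · exact absurd (hij ▸ hmemR j hj) (Finset.disjoint_left.1 (disjoint_wL_nR w) (hmemL i hi))
    · obtain ⟨K, -, -, hZ, -⟩ := hrun j hj
      exact absurd (hij ▸ hmemL i hi) (Finset.disjoint_left.1 K.2.disjoint_wL hZ)
    · exact absurd (hij ▸ hmemR i hi) (Finset.disjoint_left.1 (disjoint_wL_nR w) (hmemL j hj))
    · have h1 := hσR i hi
      rw [hij, hσR j hj] at h1
      exact Fin.ext (by omega)
    · obtain ⟨K, -, -, hZ, -⟩ := hrun j hj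
      exact absurd (hij ▸ hmemR i hi) (Finset.disjoint_left.1 K.2.disjoint_nR hZ)
    · obtain ⟨K, -, -, hZ, -⟩ := hrun i hi
      exact absurd (hij ▸ hmemL j hj) (Finset.disjoint_left.1 K.2.disjoint_wL hZ)
    · obtain ⟨K, -, -, hZ, -⟩ := hrun i hi
      exact absurd (hij ▸ hmemR j hj) (Finset.disjoint_left.1 K.2.disjoint_nR hZ)
    · obtain ⟨K, hiK, hei, hZi, -⟩ := hrun i hi
      obtain ⟨K', hjK, hej, hZj, -⟩ := hrun j hj
      by_cases hKK : K = K'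
      · subst hKK
        exact hinj K hiK hjK (hei.symm.trans (hij.trans hej))
      · have hd := disjoint_Z (K.2.disjoint K'.2 fun e => hKK (Subtype.ext e))
        exact absurd (hij ▸ hZj) (Finset.disjoint_left.1 hd hZi)
  · rw [← Finset.coe_inj, hI, hA', hAS]
    ext x
    simp only [Finset.coe_image, Finset.coe_univ, Set.image_univ, Set.mem_range, Set.mem_union,
      Set.mem_iUnion, Finset.mem_coe]
    constructor
    · rintro ⟨i, rfl⟩
      rcases hw.mem_L_or_mem_R_or_isAntiFixed i with hi | hi | hi
      · exact Or.inl (Or.inr (hmemL i hi))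
      · exact Or.inr (hmemR i hi)
      · obtain ⟨K, hiK, hei, -⟩ := hrun i hi
        refine Or.inl (Or.inl ⟨K, ?_⟩)
        rw [← himg K, hei]
        exact Finset.mem_image_of_mem _ hiK
    · rintro ((⟨K, hx⟩ | hx) | hx)
      · rw [← himg K] at hx
        obtain ⟨k, hk, rfl⟩ := Finset.mem_image.1 hx
        exact ⟨k, hσA k K hk⟩
      · obtain ⟨i, hi, hxi⟩ := mem_wL.1 hx
        exact ⟨i, Fin.ext ((hσL i hi).trans hxi.symm)⟩
      · obtain ⟨i, hi, hxi⟩ := mem_nR.1 hx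
        exact ⟨i, Fin.ext ((hσR i hi).trans hxi.symm)⟩
  · have := (w i).isLt
    rcases hw.mem_L_or_mem_R_or_isAntiFixed i with hi | hi | hi
    · exact (hσL i hi).ge
    · have := hσR i hi
      omega
    · obtain ⟨K, -, -, -, h1, -⟩ := hrun i hi
      have := isAntiFixed_iff.1 hi
      omega
  · have := (w i).isLt
    rcases hw.mem_L_or_mem_R_or_isAntiFixed i with hi | hi | hi
    · have := hσL i hi
      omega
    · exact (hσR i hi).le
    · obtain ⟨K, -, -, -, -, h2⟩ := hrun i hi
      exact h2
  · obtain ⟨K, hkK, -, hZ, h1, h2⟩ := hrun k hk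
    obtain ⟨k', hk', hor⟩ := mem_Z.1 hZ
    exact ⟨k', by rw [Fin.le_def]; omega,
      fun m hm1 hm2 => K.2.isAntiFixed (K.2.mem_of_between hk' hkK hm1 hm2), hor⟩

theorem Q_eq_runSum {w : Perm (Fin n)} (hw : Avoids123 w) : Q w = runSum w := by
  ext I
  rw [mem_Q_iff]
  exact ⟨fun ⟨_, _, hσ⟩ => hσ.mem_runSum hw, fun h => ⟨hw, exists_isRigid_of_mem_runSum hw h⟩⟩

theorem P_eq_iUnion_Q (w : Perm (Fin n)) :
    P w = ⋃ v ∈ {v : Perm (Fin n) | Avoids123 v ∧ BruhatLE w v}, Q v := by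
  ext I
  simp only [Set.mem_iUnion, exists_prop]
  constructor
  · intro hI
    obtain ⟨u, hle, hu⟩ := exists_isLocallyMaximal w hI
    exact ⟨u, ⟨hu.avoids123, hle⟩, mem_Q_iff_isLocallyMaximal.2 hu⟩
  · rintro ⟨v, ⟨-, hle⟩, hI⟩
    exact hle.P_subset hI.1

theorem iUnion_Q_eq :
    (⋃ v ∈ {v : Perm (Fin n) | Avoids123 v}, Q v) = {I : Finset (Fin (n + n)) | I.card = n} := by
  ext I
  simp only [Set.mem_iUnion, exists_prop]
  constructor
  · rintro ⟨v, -, hI⟩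
    exact card_eq_of_mem_P hI.1
  · intro hI
    obtain ⟨u, -, hu⟩ := exists_isLocallyMaximal 1 (mem_P_one hI)
    exact ⟨u, hu.avoids123, mem_Q_iff_isLocallyMaximal.2 hu⟩

end PermPositroid

theorem theorem3 (n : ℕ) :
    -- (a)
    (∀ v w : Equiv.Perm (Fin n), BruhatLE v w → P w ⊆ P v) ∧
    -- (b)
    (∀ v w : Equiv.Perm (Fin n), v ≠ w → Disjoint (Q v) (Q w)) ∧
    -- (c)
    (∀ w : Equiv.Perm (Fin n), ¬ Avoids123 w → Q w = ∅) ∧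
    -- (d): the ground sets of the summands are pairwise disjoint, and the direct sum is `Q w`
    (∀ w : Equiv.Perm (Fin n), Avoids123 w →
      (∀ K K' : Finset (Fin n), IsRun w K → IsRun w K' → K ≠ K' → Disjoint (Z K) (Z K')) ∧
      (∀ K : Finset (Fin n), IsRun w K → Disjoint (Z K) (wL w) ∧ Disjoint (Z K) (nR w)) ∧
      Disjoint (wL w) (nR w) ∧
      Q w = directSum
        (directSum (iDirectSum fun K : {K : Finset (Fin n) // IsRun w K} => shiftedCatalan K.1)
          {wL w})
        {nR w}) ∧
    -- the nonempty sets `Q v`, for `v` avoiding `123`, partition the `n`-subsets of `[2n]`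
    (∀ v : Equiv.Perm (Fin n), Avoids123 v → (Q v).Nonempty) ∧
    (⋃ v ∈ {v : Equiv.Perm (Fin n) | Avoids123 v}, Q v) =
      {I : Finset (Fin (n + n)) | I.card = n} ∧
    -- `P w` is the union of the (pairwise disjoint) `Q v` with `v ≥ w` avoiding `123`
    (∀ w : Equiv.Perm (Fin n),
      P w = ⋃ v ∈ {v : Equiv.Perm (Fin n) | Avoids123 v ∧ BruhatLE w v}, Q v) := by
  refine ⟨fun v w h => h.P_subset, fun v w h => disjoint_Q h, fun w hw => ?_, fun w hw => ?_,
    fun v hv => Q_nonempty hv, iUnion_Q_eq, P_eq_iUnion_Q⟩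
  · exact Set.eq_empty_of_forall_notMem fun I hI => hw (mem_Q_iff.1 hI).1
  · exact ⟨fun K K' hK hK' hne => disjoint_Z (hK.disjoint hK' hne),
      fun K hK => ⟨hK.disjoint_wL, hK.disjoint_nR⟩, disjoint_wL_nR w, Q_eq_runSum hw⟩
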